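/- Let $\mathbf{FinPS}$ be the category whose objects are pairs $(X,p)$ of a finite set $X$ and a probability measure $p=(p_x)_{x\in X}$ on it. A morphism $f:(X,p)\to(Y,q)$ assigns to every $x\in X$ a probability measure $f_x=(f_{yx})_{y\in Y}$ on $Y$ such that $q_y=\sum_{x}f_{yx}p_x$ for all $y\in Y$. Composition is $(g\circ f)_{zx}=\sum_y g_{zy}f_{yx}$. Write $(\bullet,1)$ for the one-point probability space and $\mathrm{bloom}_p:(\bullet,1)\to(X,p)$ for the morphism given by the measure $p$. The conditional entropy of $f:(X,p)\to(Y,q)$ is $$H(f|p)=\sum_{x\in X}p_x H(f_x),\qquad H(r)=-\sum_{y}r_y\log r_y\quad(0\log 0=0).$$ For a function $F$ assigning a real number $F(f)$ to every morphism $f$ of $\mathbf{FinPS}$, consider the following conditions. 1. (Semi-functorial) $F(g\circ f)=F(g)+F(f)$ for every composable pair $(X,p)\xrightarrow{f}(Y,q)\xrightarrow{g}(Z,r)$ for which there is a function $h:Z\times X\to Y$ with $(g\circ f)_{zx}=g_{z\,h(z,x)}f_{h(z,x)\,x}$ for all $z\in Z$ and all $x\in X$ with $p_x\neq0$. 2.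 (Convex linear) $F\big(\bigoplus_{x\in X}p_xQ^x\big)=\sum_{x\in X}p_xF(Q^x)$ for every object $(X,p)$ and every family of morphisms $Q^x:(Y_x,q^x)\to(Y'_x,q'^x)$, $x\in X$. Here $\bigoplus_{x}p_xQ^x$ is the morphism from $\coprod_xY_x$ to $\coprod_xY'_x$, with the measures that give $y\in Y_x$ the weight $p_xq^x_y$ and $y'\in Y'_x$ the weight $p_xq'^x_{y'}$, whose $(z',z)$ entry is $Q^x_{z'z}$ if $z\in Y_x$ and $z'\in Y'_x$ for the same $x$, and $0$ otherwise. 3. (Continuous) $F(f_n)\to F(f)$ whenever a sequence of morphisms $f_n:(X_n,p_n)\to(Y_n,q_n)$ converges to $f:(X,p)\to(Y,q)$, meaning that $X_n=X$ and $Y_n=Y$ for all large $n$, and $p_n\to p$ and $f_n\to f$ entrywise. 4. (Entropic Bayes' rule) $F(f)+F(\mathrm{bloom}_p)=F(\overline f)+F(\mathrm{bloom}_q)$ for every morphism $f:(X,p)\to(Y,q)$ and every Bayesian inverse $\overline f$ of $f$, i.e. every morphism $\overline f:(Y,q)\to(X,p)$ with $\overline f_{xy}q_y=f_{yx}p_x$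 for all $x\in X$, $y\in Y$. **Theorem.** If $F$ is non-negative and satisfies conditions 1-4, then there is a constant $c\ge0$ such that $F(f)=c\,H(f|p)$ for every morphism $f:(X,p)\to(Y,q)$ of $\mathbf{FinPS}$. Conversely, conditional entropy is non-negative and satisfies conditions 1-4. -/

import Mathlib

open CategoryTheory Filter Topology

universe u

noncomputable section

/-- An object of the category `FinPS`: a finite set equipped with a probability measure, i.e. with
non-negative real weights summing to `1`. -/
structure FinPS : Type (u + 1) where
  /-- The underlying set. -/
  carrier : Type u
  /-- The underlying set is finite. -/
  [fintypeCarrier : Fintype carrier]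
  /-- The probability measure. -/
  prob : stdSimplex ℝ carrier

namespace FinPS

instance instCoeSort : CoeSort FinPS.{u} (Type u) := ⟨FinPS.carrier⟩

attribute [instance] FinPS.fintypeCarrier

/-- A morphism `(X, p) ⟶ (Y, q)` in `FinPS`: a stochastic map `x ↦ f_x` from `X` to `Y`, where
`f.toFun x y` is the weight `f_{yx}` of `y` in `f_x`, such that `q_y = ∑ x, f_{yx} p_x`. -/
@[ext]
structure Hom (a b : FinPS.{u}) where
  /-- The underlying stochastic map. -/
  toFun : a → stdSimplex ℝ b
  /-- The stochastic map carries the measure of the source to the measure of the target. -/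
  map_prob : ∀ y : b, b.prob y = ∑ x : a, toFun x y * a.prob x

/-- The identity morphism: the point mass at `x` for every `x`. -/
def Hom.id (a : FinPS.{u}) : Hom a a where
  toFun x := by
    classical
    exact ⟨fun y => if y = x then 1 else 0, fun y => by dsimp only; split_ifs <;> norm_num,
      by simp⟩
  map_prob y := by
    classical
    change _ = ∑ x : a, (if y = x then (1 : ℝ) else 0) * a.prob x
    simp

/-- Composition by the Chapman-Kolmogorov equation `(g ∘ f)_{zx} = ∑ y, g_{zy} f_{yx}`. -/
def Hom.comp {a b c : FinPS.{u}} (f : Hom a b) (g : Hom b c) : Hom a c where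
  toFun x := ⟨fun z => ∑ y : b, g.toFun y z * f.toFun x y,
    fun z => Finset.sum_nonneg fun y _ =>
      mul_nonneg (stdSimplex.zero_le _ _) (stdSimplex.zero_le _ _),
    by
      rw [Finset.sum_comm]
      simp [← Finset.sum_mul]⟩
  map_prob z := by
    change _ = ∑ x : a, (∑ y : b, g.toFun y z * f.toFun x y) * a.prob x
    rw [g.map_prob z]
    simp_rw [f.map_prob, Finset.mul_sum, Finset.sum_mul]
    rw [Finset.sum_comm]
    simp_rw [mul_assoc]

instance instCategory : Category FinPS.{u} where
  Hom := Hom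
  id := Hom.id
  comp := Hom.comp
  id_comp f := by
    classical
    apply Hom.ext
    funext x
    apply Subtype.ext
    funext y
    change ∑ z, f.toFun z y * (if z = x then (1 : ℝ) else 0) = f.toFun x y
    simp
  comp_id f := by
    classical
    apply Hom.ext
    funext x
    apply Subtype.ext
    funext y
    change ∑ z, (if y = z then (1 : ℝ) else 0) * f.toFun x z = f.toFun x y
    simp
  assoc f g h := by
    apply Hom.ext
    funext x
    apply Subtype.ext
    funext w
    change ∑ z, h.toFun z w * ∑ y, g.toFun y z * f.toFun x y =
      ∑ y, (∑ z, h.toFun z w * g.toFun y z) * f.toFun x y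
    simp_rw [Finset.mul_sum, Finset.sum_mul]
    rw [Finset.sum_comm]
    simp_rw [mul_assoc]

theorem comp_apply {a b c : FinPS.{u}} (f : a ⟶ b) (g : b ⟶ c) (x : a) (z : c) :
    (f ≫ g).toFun x z = ∑ y : b, g.toFun y z * f.toFun x y := rfl

/-- The object `(•, 1)`: a one-element set with its unique probability measure. -/
abbrev point : FinPS.{u} where
  carrier := PUnit.{u + 1}
  prob := ⟨fun _ => 1, fun _ => zero_le_one, by simp⟩

/-- The bloom of `(X, p)`: the morphism `(•, 1) ⟶ (X, p)` whose underlying stochastic map is the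
measure `p`. -/
def bloom (a : FinPS.{u}) : point.{u} ⟶ a where
  toFun _ := a.prob
  map_prob y := by
    change _ = ∑ _x : PUnit, a.prob y * 1
    simp

/-- The `p`-weighted convex sum of objects `(Y_x, q^x)` indexed by the elements of `(X, p)`: the
disjoint union of the `Y_x`, where `z ∈ Y_x` has weight `p_x q^x_z`. -/
abbrev convexSum (a : FinPS.{u}) (Y : a → FinPS.{u}) : FinPS.{u} where
  carrier := Σ x : a, Y x
  prob := ⟨fun z => a.prob z.1 * (Y z.1).prob z.2,
    fun _ => mul_nonneg (stdSimplex.zero_le _ _) (stdSimplex.zero_le _ _),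
    by
      rw [Fintype.sum_sigma]
      simp_rw [← Finset.mul_sum]
      have h : ∀ x : a, ∑ y : Y x, (Y x).prob y = 1 := fun x => stdSimplex.sum_eq_one _
      simp_rw [h, mul_one]
      exact stdSimplex.sum_eq_one _⟩

open scoped Classical in
/-- The block-diagonal weights of a convex sum of morphisms: `Q^x_{z'z}` if `z` and `z'` lie over
the same `x`, and `0` otherwise. -/
def blockWeight {a : FinPS.{u}} {Y Y' : a → FinPS.{u}} (Q : ∀ x : a, Y x ⟶ Y' x)
    (z : Σ x : a, Y x) (z' : Σ x : a, Y' x) : ℝ :=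
  if h : z'.1 = z.1 then (Q z.1).toFun z.2 (h ▸ z'.2) else 0

theorem blockWeight_same {a : FinPS.{u}} {Y Y' : a → FinPS.{u}} (Q : ∀ x : a, Y x ⟶ Y' x)
    (x : a) (y : Y x) (y' : Y' x) :
    blockWeight Q ⟨x, y⟩ ⟨x, y'⟩ = (Q x).toFun y y' := by
  simp [blockWeight]

theorem blockWeight_of_ne {a : FinPS.{u}} {Y Y' : a → FinPS.{u}} (Q : ∀ x : a, Y x ⟶ Y' x)
    {z : Σ x : a, Y x} {z' : Σ x : a, Y' x} (h : z'.1 ≠ z.1) : blockWeight Q z z' = 0 := by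
  simp [blockWeight, h]

/-- The `p`-weighted convex sum of morphisms `Q^x : (Y_x, q^x) ⟶ (Y'_x, q'^x)` indexed by the
elements of `(X, p)`. -/
def convexSumHom (a : FinPS.{u}) {Y Y' : a → FinPS.{u}} (Q : ∀ x : a, Y x ⟶ Y' x) :
    a.convexSum Y ⟶ a.convexSum Y' where
  toFun z := ⟨blockWeight Q z,
    fun z' => by
      unfold blockWeight
      split_ifs
      · exact stdSimplex.zero_le _ _
      · exact le_rfl,
    by
      obtain ⟨x, y⟩ := z
      change ∑ z' : Σ x : a, Y' x, blockWeight Q ⟨x, y⟩ z' = 1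
      rw [Fintype.sum_sigma, Finset.sum_eq_single x]
      · simp_rw [blockWeight_same]
        exact stdSimplex.sum_eq_one _
      · intro x' _ hx
        exact Finset.sum_eq_zero fun y' _ => blockWeight_of_ne Q hx
      · simp⟩
  map_prob z' := by
    obtain ⟨x, y'⟩ := z'
    change a.prob x * (Y' x).prob y' = ∑ z : Σ x : a, Y x,
      blockWeight Q z ⟨x, y'⟩ * (a.prob z.1 * (Y z.1).prob z.2)
    rw [Fintype.sum_sigma, Finset.sum_eq_single x]
    · simp_rw [blockWeight_same]
      rw [(Q x).map_prob y', Finset.mul_sum]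
      exact Finset.sum_congr rfl fun y _ => by ring
    · intro x' _ hx
      exact Finset.sum_eq_zero fun y _ => by rw [blockWeight_of_ne Q (Ne.symm hx), zero_mul]
    · simp

/-- A real-valued function on the morphisms of `FinPS`; equivalently, a (not necessarily functorial)
function from `FinPS` to the one-object category `Bℝ`, on whose single object there is nothing
to specify. -/
abbrev MorphismFunction : Type (u + 1) := ∀ ⦃a b : FinPS.{u}⦄, (a ⟶ b) → ℝ

/-- A mediator of `(X, p) ⟶ (Y, q) ⟶ (Z, r)`: a function `h : Z × X → Y` with
`(g ∘ f)_{zx} = g_{z h(z,x)} f_{h(z,x) x}` for all `z` and all `x` with `p_x ≠ 0`. -/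
def IsMediator {a b c : FinPS.{u}} (f : a ⟶ b) (g : b ⟶ c) (h : c × a → b) : Prop :=
  ∀ (z : c) (x : a), a.prob x ≠ 0 →
    (f ≫ g).toFun x z = g.toFun (h (z, x)) z * f.toFun x (h (z, x))

/-- A composable pair is a.e. coalescable if it admits a mediator. -/
def AECoalescable {a b c : FinPS.{u}} (f : a ⟶ b) (g : b ⟶ c) : Prop :=
  ∃ h : c × a → b, IsMediator f g h

/-- `F (g ∘ f) = F g + F f` for every a.e. coalescable pair. -/
def SemiFunctorial (F : MorphismFunction.{u}) : Prop :=
  ∀ ⦃a b c : FinPS.{u}⦄ (f : a ⟶ b) (g : b ⟶ c), AECoalescable f g → F (f ≫ g) = F g + F f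

/-- `F (⨁ p_x Q^x) = ∑ x, p_x F (Q^x)` for every object `(X, p)` and every family of morphisms
indexed by `X`. -/
def ConvexLinear (F : MorphismFunction.{u}) : Prop :=
  ∀ (a : FinPS.{u}) (Y Y' : a → FinPS.{u}) (Q : ∀ x : a, Y x ⟶ Y' x),
    F (a.convexSumHom Q) = ∑ x : a, a.prob x * F (Q x)

/-- Convergence of a sequence of morphisms `(X_n, p_n) ⟶ (Y_n, q_n)` to `(X, p) ⟶ (Y, q)`:
from some index `N` on, `X_n = X` and `Y_n = Y`, so that the `n`-th morphism is a morphism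
`f_n : (X, p_n) ⟶ (Y, q_n)`, and `p_n → p` and `f_n → f`. (The values of the auxiliary
sequences `p`, `q`, `f` below `N` play no role.) -/
def ConvergesTo (s : ℕ → Arrow FinPS.{u}) (m : Arrow FinPS.{u}) : Prop :=
  ∃ (N : ℕ) (p : ℕ → stdSimplex ℝ m.left) (q : ℕ → stdSimplex ℝ m.right)
    (f : ∀ n, FinPS.mk m.left (p n) ⟶ FinPS.mk m.right (q n)),
    (∀ n ≥ N, s n = Arrow.mk (f n)) ∧
    Tendsto p atTop (𝓝 m.left.prob) ∧
    Tendsto (fun n => (f n).toFun) atTop (𝓝 m.hom.toFun)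

/-- `F (f_n) → F f` whenever `f_n` converges to `f`. -/
def ContinuousFunction (F : MorphismFunction.{u}) : Prop :=
  ∀ (s : ℕ → Arrow FinPS.{u}) (m : Arrow FinPS.{u}), ConvergesTo s m →
    Tendsto (fun n => F (s n).hom) atTop (𝓝 (F m.hom))

/-- `g : (Y, q) ⟶ (X, p)` is a Bayesian inverse of `f : (X, p) ⟶ (Y, q)` if
`g_{xy} q_y = f_{yx} p_x` for all `x` and `y`. -/
def IsBayesianInverse {a b : FinPS.{u}} (f : a ⟶ b) (g : b ⟶ a) : Prop :=
  ∀ (x : a) (y : b), g.toFun y x * b.prob y = f.toFun x y * a.prob x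

/-- The entropic Bayes' rule: `F f + F (bloom p) = F f' + F (bloom q)` for every morphism
`f : (X, p) ⟶ (Y, q)` and every Bayesian inverse `f'` of `f`. -/
def EntropicBayesRule (F : MorphismFunction.{u}) : Prop :=
  ∀ ⦃a b : FinPS.{u}⦄ (f : a ⟶ b) (f' : b ⟶ a), IsBayesianInverse f f' →
    F f + F (bloom a) = F f' + F (bloom b)

/-- The Shannon entropy `H(p) = -∑ x, p_x log p_x`, with `0 log 0 = 0`. -/
def shannonEntropy {X : Type u} [Fintype X] (p : stdSimplex ℝ X) : ℝ :=
  -∑ x, p x * Real.log (p x)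

/-- The conditional entropy `H(f|p) = ∑ x, p_x H(f_x)` of `f : (X, p) ⟶ (Y, q)`. -/
def condEntropy : MorphismFunction.{u} :=
  fun a _ f => ∑ x : a, a.prob x * shannonEntropy (f.toFun x)

end FinPS

end

/-! ### Conditional entropy satisfies the axioms. -/

namespace FinPS

/-! The converse is the product rule for `Real.negMulLog`: a mediator leaves at most one nonzero
term in each Chapman-Kolmogorov sum, and both sides of Bayes' rule are the entropy of the joint
distribution.

For uniqueness, `F` vanishes on measure-preserving bijections. A convex sum of blooms after a bloom
is coalescable, which gives the chain rule `IsEntropic.map_bloom_convexSum`. Bayes' rule then makes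
`F` vanish on the projection of a convex sum to its index (`IsEntropic.map_sumProj`). Every `f`
factors through its joint distribution as a convex sum of the blooms of the `f_x` followed by such a
projection, up to a bijection, so `F f` is the `p`-average of `F` on the blooms of the `f_x`
(`IsEntropic.map_eq_sum`).

What remains is a Faddeev-type characterisation of Shannon entropy. On uniform distributions the
chain rule makes `F` a completely additive function of the cardinality. Continuity makes its
increments tend to `0`, so it is a multiple of the logarithm (`eq_mul_log_of_additive`). The chain
rule extends the formula to rational measures of full support, and density extends it to all
measures. -/

theorem shannonEntropy_eq_sum_negMulLog {X : Type u} [Fintype X] (p : stdSimplex ℝ X) :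
    shannonEntropy p = ∑ x, Real.negMulLog (p x) := by
  simp [shannonEntropy, Real.negMulLog]

theorem condEntropy_eq_sum {a b : FinPS.{u}} (f : a ⟶ b) :
    condEntropy f = ∑ x : a, a.prob x * ∑ y : b, Real.negMulLog (f.toFun x y) := by
  simp [condEntropy, shannonEntropy_eq_sum_negMulLog]

theorem condEntropy_nonneg {a b : FinPS.{u}} (f : a ⟶ b) : 0 ≤ condEntropy f := by
  rw [condEntropy_eq_sum]
  exact Finset.sum_nonneg fun x _ => mul_nonneg (stdSimplex.zero_le _ _)
    (Finset.sum_nonneg fun y _ =>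
      Real.negMulLog_nonneg (stdSimplex.zero_le _ _) (stdSimplex.le_one _ _))

/-- If non-negative terms sum to one of them, the others vanish, and `Real.negMulLog` vanishes at
`0`. -/
theorem negMulLog_sum_of_mediator {ι : Type*} [Fintype ι] (w : ι → ℝ) (hw : ∀ i, 0 ≤ w i)
    (j : ι) (h : ∑ i, w i = w j) :
    Real.negMulLog (∑ i, w i) = ∑ i, Real.negMulLog (w i) := by
  classical
  have h0 : ∀ i, i ≠ j → w i = 0 := by
    rw [← Finset.add_sum_erase _ _ (Finset.mem_univ j), add_eq_left,
      Finset.sum_eq_zero_iff_of_nonneg fun i _ => hw i] at h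
    exact fun i hi => h i (Finset.mem_erase.2 ⟨hi, Finset.mem_univ _⟩)
  rw [h, Finset.sum_eq_single j]
  · intro i _ hi
    rw [h0 i hi, Real.negMulLog_zero]
  · simp

theorem sum_prob_mul_sum {a b : FinPS.{u}} (f : a ⟶ b) (G : b → ℝ) :
    ∑ x : a, a.prob x * ∑ y : b, f.toFun x y * G y = ∑ y : b, b.prob y * G y := by
  simp_rw [f.map_prob, Finset.mul_sum, Finset.sum_mul]
  rw [Finset.sum_comm]
  exact Finset.sum_congr rfl fun y _ => Finset.sum_congr rfl fun x _ => by ring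

theorem condEntropy_semiFunctorial : SemiFunctorial condEntropy.{u} := by
  rintro a b c f g ⟨h, hh⟩
  have key : ∀ x : a, a.prob x * ∑ z : c, Real.negMulLog ((f ≫ g).toFun x z) =
      a.prob x * (∑ y : b, f.toFun x y * ∑ z : c, Real.negMulLog (g.toFun y z)) +
      a.prob x * ∑ y : b, Real.negMulLog (f.toFun x y) := by
    intro x
    -- The mediator says nothing at points of measure zero, but these carry no weight.
    by_cases hx : a.prob x = 0
    · simp [hx]
    have hz : ∀ z : c, Real.negMulLog ((f ≫ g).toFun x z) =
        ∑ y : b, (f.toFun x y * Real.negMulLog (g.toFun y z) +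
          g.toFun y z * Real.negMulLog (f.toFun x y)) := by
      intro z
      have := hh z x hx
      rw [comp_apply] at this ⊢
      rw [negMulLog_sum_of_mediator _
        (fun y => mul_nonneg (stdSimplex.zero_le _ _) (stdSimplex.zero_le _ _)) (h (z, x)) this]
      exact Finset.sum_congr rfl fun y _ => Real.negMulLog_mul _ _
    simp_rw [hz]
    rw [← mul_add, Finset.sum_comm, ← Finset.sum_add_distrib]
    congr 1
    refine Finset.sum_congr rfl fun y _ => ?_
    rw [Finset.sum_add_distrib, ← Finset.mul_sum, ← Finset.sum_mul, stdSimplex.sum_eq_one, one_mul]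
  rw [condEntropy_eq_sum, condEntropy_eq_sum, condEntropy_eq_sum, Finset.sum_congr rfl
    fun x _ => key x, Finset.sum_add_distrib]
  rw [sum_prob_mul_sum]

theorem condEntropy_convexLinear : ConvexLinear condEntropy.{u} := by
  intro a Y Y' Q
  have key : ∀ (x : a) (y : Y x),
      ∑ z : (Σ x : a, Y' x), Real.negMulLog (blockWeight Q ⟨x, y⟩ z) =
        ∑ y' : Y' x, Real.negMulLog ((Q x).toFun y y') := by
    intro x y
    rw [Fintype.sum_sigma, Finset.sum_eq_single x]
    · simp_rw [blockWeight_same]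
    · intro x' _ hx
      exact Finset.sum_eq_zero fun y' _ => by rw [blockWeight_of_ne Q hx, Real.negMulLog_zero]
    · simp
  rw [condEntropy_eq_sum]
  change ∑ z : (Σ x : a, Y x), a.prob z.1 * (Y z.1).prob z.2 *
    ∑ z' : (Σ x : a, Y' x), Real.negMulLog (blockWeight Q z z') = _
  rw [Fintype.sum_sigma]
  refine Finset.sum_congr rfl fun x _ => ?_
  rw [condEntropy_eq_sum, Finset.mul_sum]
  exact Finset.sum_congr rfl fun y _ => by rw [key, mul_assoc]

theorem continuous_stdSimplex_apply {X : Type u} [Fintype X] (x : X) :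
    Continuous fun p : stdSimplex ℝ X => p x :=
  (continuous_apply x).comp continuous_subtype_val

theorem continuous_shannonEntropy {X : Type u} [Fintype X] :
    Continuous fun p : stdSimplex ℝ X => shannonEntropy p := by
  simp_rw [shannonEntropy_eq_sum_negMulLog]
  exact continuous_finsetSum _ fun x _ =>
    Real.continuous_negMulLog.comp (continuous_stdSimplex_apply x)

theorem tendsto_sum_mul_shannonEntropy {X Y : Type u} [Fintype X] [Fintype Y]
    {p : ℕ → stdSimplex ℝ X} {p' : stdSimplex ℝ X} {f : ℕ → X → stdSimplex ℝ Y}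
    {f' : X → stdSimplex ℝ Y} (hp : Tendsto p atTop (𝓝 p')) (hf : Tendsto f atTop (𝓝 f')) :
    Tendsto (fun n => ∑ x, p n x * shannonEntropy (f n x)) atTop
      (𝓝 (∑ x, p' x * shannonEntropy (f' x))) :=
  tendsto_finsetSum _ fun x _ =>
    (((continuous_stdSimplex_apply x).tendsto _).comp hp).mul
      ((continuous_shannonEntropy.tendsto _).comp (tendsto_pi_nhds.1 hf x))

theorem condEntropy_continuousFunction : ContinuousFunction condEntropy.{u} := by
  rintro s m ⟨N, p, q, f, hs, hp, hf⟩
  refine (tendsto_sum_mul_shannonEntropy hp hf).congr' ?_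
  filter_upwards [eventually_ge_atTop N] with n hn
  rw [hs n hn]
  rfl

/-- The right side is the entropy of the joint distribution, which a Bayesian inverse shares up to
exchanging the factors. -/
theorem condEntropy_add_condEntropy_bloom {a b : FinPS.{u}} (f : a ⟶ b) :
    condEntropy f + condEntropy (bloom a) =
      ∑ x : a, ∑ y : b, Real.negMulLog (f.toFun x y * a.prob x) := by
  have hb : condEntropy (bloom a) = ∑ x : a, Real.negMulLog (a.prob x) := by
    rw [condEntropy_eq_sum]
    change ∑ _x : PUnit, (1 : ℝ) * _ = _
    simp [bloom]
  rw [hb, condEntropy_eq_sum, ← Finset.sum_add_distrib]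
  refine Finset.sum_congr rfl fun x _ => ?_
  simp_rw [Real.negMulLog_mul]
  rw [Finset.sum_add_distrib, ← Finset.mul_sum, ← Finset.sum_mul, stdSimplex.sum_eq_one, one_mul]

theorem condEntropy_entropicBayesRule : EntropicBayesRule condEntropy.{u} := by
  intro a b f f' h
  rw [condEntropy_add_condEntropy_bloom, condEntropy_add_condEntropy_bloom, Finset.sum_comm]
  exact Finset.sum_congr rfl fun y _ => Finset.sum_congr rfl fun x _ => by rw [h x y]

end FinPS

/-! ### Completely additive functions with increments tending to zero. -/

/-- Subtracting the multiple of `log` that agrees with `φ` at `2` leaves an additive `g` with `g (2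
* m) = g m`. Repeated halving then costs at most `ε * log 2` per step, so `g` is `o(log n)`;
evaluating on powers of `n` forces `g n = 0`. -/
theorem eq_mul_log_of_additive {φ : ℕ → ℝ}
    (hmul : ∀ m n, 0 < m → 0 < n → φ (m * n) = φ m + φ n)
    (hlim : Tendsto (fun n => φ (n + 1) - φ n) atTop (𝓝 0)) (n : ℕ) (hn : 0 < n) :
    φ n = φ 2 / Real.log 2 * Real.log n := by
  have hlog2 : 0 < Real.log 2 := Real.log_pos one_lt_two
  set c := φ 2 / Real.log 2 with hc
  set g : ℕ → ℝ := fun n => φ n - c * Real.log n with hg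
  have gmul : ∀ m n, 0 < m → 0 < n → g (m * n) = g m + g n := by
    intro m n hm hn
    have hm' : (m : ℝ) ≠ 0 := by positivity
    have hn' : (n : ℝ) ≠ 0 := by positivity
    simp only [hg, hmul m n hm hn, Nat.cast_mul, Real.log_mul hm' hn']
    ring
  have g2 : g 2 = 0 := by
    simp only [hg, hc, Nat.cast_ofNat]
    field_simp
    ring
  have glim : Tendsto (fun n => g (n + 1) - g n) atTop (𝓝 0) := by
    have h1 : Tendsto (fun n : ℕ => Real.log (n + 1) - Real.log n) atTop (𝓝 0) :=
      Real.tendsto_log_nat_add_one_sub_log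
    have h2 := hlim.sub (h1.const_mul c)
    simp only [mul_zero, sub_zero] at h2
    refine h2.congr fun n => ?_
    simp only [hg, Nat.cast_add, Nat.cast_one]
    ring
  have bound : ∀ ε > 0, ∃ C, ∀ n, 0 < n → |g n| ≤ C + ε * Real.log n := by
    intro ε hε
    obtain ⟨N, hN⟩ := Metric.tendsto_atTop.1 glim (ε * Real.log 2) (by positivity)
    -- The sum dominates every value below `2 * N + 2`; from there on, the half `m` is positive and
    -- `2 * m` lies beyond `N`.
    refine ⟨∑ k ∈ Finset.range (2 * N + 2), |g k|, fun n => ?_⟩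
    induction n using Nat.strong_induction_on with
    | _ n ih =>
      intro hn
      rcases lt_or_ge n (2 * N + 2) with hlt | hge
      · have h1 := Finset.single_le_sum (f := fun k => |g k|) (fun k _ => abs_nonneg _)
          (Finset.mem_range.2 hlt)
        have h2 : 0 ≤ Real.log n := Real.log_natCast_nonneg n
        have h3 : 0 ≤ ε * Real.log n := by positivity
        linarith
      · obtain ⟨m, hm⟩ : ∃ m, n = 2 * m ∨ n = 2 * m + 1 := ⟨n / 2, by omega⟩
        have hm0 : 0 < m := by omega
        have hgm : g (2 * m) = g m := by rw [gmul 2 m two_pos hm0, g2, zero_add]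
        have hle : |g n| ≤ |g m| + ε * Real.log 2 := by
          rcases hm with rfl | rfl
          · rw [hgm]
            have : 0 ≤ ε * Real.log 2 := by positivity
            linarith
          · have h1 := hN (2 * m) (by omega)
            rw [Real.dist_eq, sub_zero, hgm] at h1
            have h2 := abs_add_le (g m) (g (2 * m + 1) - g m)
            rw [add_sub_cancel] at h2
            linarith
        have h1 := ih m (by omega) hm0
        have hm' : (0 : ℝ) < m := by exact_mod_cast hm0
        have h2 : Real.log 2 + Real.log m ≤ Real.log n := by
          rw [← Real.log_mul two_ne_zero hm'.ne']
          apply Real.log_le_log (by positivity)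
          exact_mod_cast (by omega : 2 * m ≤ n)
        have h3 := mul_le_mul_of_nonneg_left h2 hε.le
        linarith
  have gpow : ∀ k : ℕ, g (n ^ (k + 1)) = (k + 1) * g n := by
    intro k
    induction k with
    | zero => simp
    | succ k ih =>
      rw [pow_succ, gmul _ _ (pow_pos hn _) hn, ih]
      push_cast
      ring
  have habs : ∀ ε > 0, |g n| ≤ ε * Real.log n := by
    intro ε hε
    obtain ⟨C, hC⟩ := bound ε hε
    refine le_of_forall_pos_le_add fun δ hδ => ?_
    -- On the power `n ^ (k + 1)` both `g` and `log` scale by `k + 1`, so the constant contributes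
    -- only `C / (k + 1) < δ`.
    obtain ⟨k, hk⟩ := exists_nat_gt (C / δ)
    have h1 := hC (n ^ (k + 1)) (pow_pos hn _)
    have hk0 : (0 : ℝ) < (k : ℝ) + 1 := by positivity
    rw [gpow, abs_mul, abs_of_pos hk0, Nat.cast_pow, Real.log_pow] at h1
    push_cast at h1
    rw [div_lt_iff₀ hδ] at hk
    refine le_of_mul_le_mul_left ?_ hk0
    nlinarith
  have hzero : |g n| ≤ 0 := by
    refine le_of_forall_pos_le_add fun δ hδ => ?_
    have h0 : 0 ≤ Real.log n := Real.log_natCast_nonneg n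
    -- The added `1` covers `n = 1`, where the logarithm vanishes.
    refine (habs (δ / (Real.log n + 1)) (by positivity)).trans ?_
    rw [zero_add, div_mul_eq_mul_div, div_le_iff₀ (by positivity)]
    nlinarith
  have := abs_nonpos_iff.1 hzero
  simp only [hg] at this
  linarith

/-- The increment is `η n - φ n / (n + 1)`. Since `φ` is non-negative, `φ n` is at most `φ 0` plus a
partial sum of `η`, and Cesàro averaging gives `φ n / (n + 1) → 0`. -/
theorem tendsto_sub_of_weighted_recursion {φ : ℕ → ℝ} (h0 : ∀ n, 0 ≤ φ n)
    (h : Tendsto (fun n : ℕ => φ (n + 1) - n / (n + 1) * φ n) atTop (𝓝 0)) :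
    Tendsto (fun n => φ (n + 1) - φ n) atTop (𝓝 0) := by
  set η : ℕ → ℝ := fun n => φ (n + 1) - n / (n + 1) * φ n with hη
  have hle : ∀ n, φ n ≤ φ 0 + ∑ k ∈ Finset.range n, η k := by
    intro n
    induction n with
    | zero => simp
    | succ n ih =>
      rw [Finset.sum_range_succ]
      have h1 : φ (n + 1) = η n + n / (n + 1) * φ n := by simp [hη]
      have h2 : (n : ℝ) / (n + 1) ≤ 1 := by
        rw [div_le_one (by positivity)]
        linarith
      have h3 := mul_le_of_le_one_left (h0 n) h2
      linarith
  have hdiv : Tendsto (fun n : ℕ => φ n / (n + 1)) atTop (𝓝 0) := by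
    have h1 : Tendsto (fun n : ℕ => (n : ℝ)⁻¹ * φ 0 + (n : ℝ)⁻¹ * ∑ k ∈ Finset.range n, η k)
        atTop (𝓝 0) := by
      have := ((tendsto_inv_atTop_nhds_zero_nat (𝕜 := ℝ)).mul_const (φ 0)).add h.cesaro
      simpa using this
    refine squeeze_zero' (Eventually.of_forall fun n => div_nonneg (h0 n) (by positivity)) ?_ h1
    filter_upwards [eventually_gt_atTop 0] with n hn
    have hn' : (0 : ℝ) < n := by exact_mod_cast hn
    rw [← mul_add, inv_mul_eq_div]
    exact div_le_div₀ ((h0 n).trans (hle n)) (hle n) hn' (by linarith)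
  have := h.sub hdiv
  rw [sub_zero] at this
  refine this.congr fun n => ?_
  simp only [hη]
  field_simp
  ring

/-! ### Bijections, convex sums of blooms, and factorisation through the joint distribution. -/

noncomputable section

namespace FinPS

open scoped Classical in
/-- The deterministic morphism given by a measure-preserving function. -/
def ofFun {a b : FinPS.{u}} (φ : a → b)
    (h : ∀ y : b, b.prob y = ∑ x : a, (if y = φ x then (1 : ℝ) else 0) * a.prob x) : a ⟶ b where
  toFun x := ⟨fun y => if y = φ x then 1 else 0, fun y => by dsimp only; split_ifs <;> norm_num,
    by simp⟩
  map_prob := h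

open scoped Classical in
theorem ofFun_apply {a b : FinPS.{u}} (φ : a → b)
    (h : ∀ y : b, b.prob y = ∑ x : a, (if y = φ x then (1 : ℝ) else 0) * a.prob x) (x : a)
    (y : b) : (ofFun φ h).toFun x y = if y = φ x then 1 else 0 := rfl

/-- The isomorphism given by a measure-preserving bijection. -/
def ofEquiv {a b : FinPS.{u}} (e : a.carrier ≃ b.carrier)
    (h : ∀ x : a, b.prob (e x) = a.prob x) : a ⟶ b :=
  ofFun e fun y => by
    classical
    rw [Finset.sum_eq_single (e.symm y)]
    · simp [← h]
    · intro x _ hx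
      rw [if_neg, zero_mul]
      rintro rfl
      simp at hx
    · simp

open scoped Classical in
theorem ofEquiv_apply {a b : FinPS.{u}} (e : a.carrier ≃ b.carrier)
    (h : ∀ x : a, b.prob (e x) = a.prob x) (x : a) (y : b) :
    (ofEquiv e h).toFun x y = if y = e x then 1 else 0 := rfl

theorem hom_ext {a b : FinPS.{u}} {f g : a ⟶ b} (h : ∀ x y, f.toFun x y = g.toFun x y) :
    f = g := by
  apply Hom.ext
  funext x
  apply Subtype.ext
  funext y
  exact h x y

theorem ofEquiv_comp_symm {a b : FinPS.{u}} (e : a.carrier ≃ b.carrier)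
    (h : ∀ x : a, b.prob (e x) = a.prob x) (h' : ∀ y : b, a.prob (e.symm y) = b.prob y) :
    ofEquiv e h ≫ ofEquiv e.symm h' = 𝟙 a := by
  classical
  refine hom_ext fun x x' => ?_
  change ∑ y : b, (if x' = e.symm y then (1 : ℝ) else 0) * (if y = e x then 1 else 0) =
    if x' = x then 1 else 0
  simp

open scoped Classical in
theorem ofFun_comp_apply {a b c : FinPS.{u}} (φ : a → b)
    (h : ∀ y : b, b.prob y = ∑ x : a, (if y = φ x then (1 : ℝ) else 0) * a.prob x)
    (g : b ⟶ c) (x : a) (z : c) : (ofFun φ h ≫ g).toFun x z = g.toFun (φ x) z := by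
  rw [comp_apply]
  simp [ofFun_apply]

theorem ofEquiv_comp_apply {a b c : FinPS.{u}} (e : a.carrier ≃ b.carrier)
    (h : ∀ x : a, b.prob (e x) = a.prob x) (g : b ⟶ c) (x : a) (z : c) :
    (ofEquiv e h ≫ g).toFun x z = g.toFun (e x) z :=
  ofFun_comp_apply _ _ _ _ _

open scoped Classical in
theorem aecoalescable_ofFun_left {a b c : FinPS.{u}} (φ : a → b)
    (h : ∀ y : b, b.prob y = ∑ x : a, (if y = φ x then (1 : ℝ) else 0) * a.prob x)
    (g : b ⟶ c) : AECoalescable (ofFun φ h) g := by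
  refine ⟨fun zx => φ zx.2, fun z x _ => ?_⟩
  rw [ofFun_comp_apply, ofFun_apply, if_pos rfl, mul_one]

theorem aecoalescable_ofEquiv_left {a b c : FinPS.{u}} (e : a.carrier ≃ b.carrier)
    (h : ∀ x : a, b.prob (e x) = a.prob x) (g : b ⟶ c) : AECoalescable (ofEquiv e h) g :=
  aecoalescable_ofFun_left _ _ _

/-- Bijectivity recovers the intermediate point from the end point; a function that identifies
points need not allow this. -/
theorem aecoalescable_ofEquiv_right {a b c : FinPS.{u}} (f : a ⟶ b) (e : b.carrier ≃ c.carrier)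
    (h : ∀ x : b, c.prob (e x) = b.prob x) : AECoalescable f (ofEquiv e h) := by
  classical
  refine ⟨fun zx => e.symm zx.1, fun z x _ => ?_⟩
  rw [comp_apply, Finset.sum_eq_single (e.symm z)]
  · intro y _ hy
    rw [ofEquiv_apply, if_neg, zero_mul]
    rintro rfl
    simp at hy
  · simp

/-- The unique morphism to the one-point space. -/
def toPoint (a : FinPS.{u}) : a ⟶ point.{u} where
  toFun _ := point.prob
  map_prob _ := by
    change (1 : ℝ) = ∑ x : a, 1 * a.prob x
    simp

theorem bloom_toPoint (a : FinPS.{u}) : bloom a ≫ toPoint a = 𝟙 point := by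
  refine hom_ext fun x y => ?_
  have h1 : (bloom a ≫ toPoint a).toFun x y = 1 := by
    change ∑ z : a, 1 * a.prob z = 1
    simp
  have h2 : (𝟙 point.{u} : point.{u} ⟶ point.{u}).toFun x y = 1 := if_pos rfl
  rw [h1, h2]

/-- The equivalence of `X` with a disjoint union of points indexed by `X`. -/
def sigmaPointEquiv (a : FinPS.{u}) : a.carrier ≃ (a.convexSum fun _ => point.{u}).carrier where
  toFun x := ⟨x, PUnit.unit⟩
  invFun z := z.1
  left_inv _ := rfl
  right_inv _ := rfl

theorem prob_sigmaPointEquiv (a : FinPS.{u}) (x : a) :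
    (a.convexSum fun _ => point.{u}).prob (sigmaPointEquiv a x) = a.prob x :=
  mul_one (a.prob x)

/-- The morphism `x ↦ δ_x ⊗ q^x` from `(X, p)` to a convex sum indexed by it. -/
def sumBloom (a : FinPS.{u}) (Y : a → FinPS.{u}) : a ⟶ a.convexSum Y :=
  ofEquiv (sigmaPointEquiv a) (prob_sigmaPointEquiv a) ≫ a.convexSumHom fun x => bloom (Y x)

theorem sumBloom_same (a : FinPS.{u}) (Y : a → FinPS.{u}) (x : a) (y : Y x) :
    (sumBloom a Y).toFun x ⟨x, y⟩ = (Y x).prob y := by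
  rw [sumBloom, ofEquiv_comp_apply]
  exact blockWeight_same (fun x => bloom (Y x)) x PUnit.unit y

theorem sumBloom_of_ne (a : FinPS.{u}) (Y : a → FinPS.{u}) {x : a} {z : a.convexSum Y}
    (h : z.1 ≠ x) : (sumBloom a Y).toFun x z = 0 := by
  rw [sumBloom, ofEquiv_comp_apply]
  exact blockWeight_of_ne (fun x => bloom (Y x)) h

theorem bloom_comp_sumBloom (a : FinPS.{u}) (Y : a → FinPS.{u}) :
    bloom a ≫ sumBloom a Y = bloom (a.convexSum Y) := by
  refine hom_ext fun _ z => ?_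
  rw [comp_apply, Finset.sum_eq_single z.1]
  · rw [sumBloom_same, mul_comm]
    rfl
  · intro x _ hx
    rw [sumBloom_of_ne a Y hx.symm, zero_mul]
  · simp

/-- An element of the disjoint union remembers its index, so the intermediate point is determined by
the end point. -/
theorem aecoalescable_bloom_sumBloom (a : FinPS.{u}) (Y : a → FinPS.{u}) :
    AECoalescable (bloom a) (sumBloom a Y) := by
  refine ⟨fun zx => zx.1.1, fun z _ _ => ?_⟩
  rw [comp_apply, Finset.sum_eq_single z.1]
  · intro x _ hx
    rw [sumBloom_of_ne a Y hx.symm, zero_mul]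
  · simp

/-- The projection of a convex sum to its indexing object. -/
def sumProj (a : FinPS.{u}) (Y : a → FinPS.{u}) : a.convexSum Y ⟶ a :=
  ofFun Sigma.fst fun x => by
    classical
    change a.prob x = ∑ z : (Σ x : a, Y x), _ * (a.prob z.1 * (Y z.1).prob z.2)
    rw [Fintype.sum_sigma]
    have h : ∀ x : a, ∑ y : Y x, (Y x).prob y = 1 := fun x => stdSimplex.sum_eq_one _
    simp [← Finset.mul_sum, h]

theorem isBayesianInverse_sumProj (a : FinPS.{u}) (Y : a → FinPS.{u}) :
    IsBayesianInverse (sumProj a Y) (sumBloom a Y) := by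
  classical
  rintro ⟨x', y⟩ x
  by_cases h : x' = x
  · subst h
    rw [sumBloom_same, sumProj, ofFun_apply, if_pos rfl, one_mul, mul_comm]
    rfl
  · rw [sumBloom_of_ne a Y (show (⟨x', y⟩ : a.convexSum Y).1 ≠ x from h), sumProj, ofFun_apply,
      if_neg (Ne.symm h), zero_mul, zero_mul]

open scoped Classical in
/-- The posterior distribution given `y`, with an arbitrary value if `y` has measure zero. -/
def posterior {a b : FinPS.{u}} (f : a ⟶ b) (y : b) : stdSimplex ℝ a :=
  if h : b.prob y = 0 then a.prob else
    ⟨fun x => f.toFun x y * a.prob x / b.prob y,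
      fun _ => div_nonneg (mul_nonneg (stdSimplex.zero_le _ _) (stdSimplex.zero_le _ _))
        (stdSimplex.zero_le _ _),
      by rw [← Finset.sum_div, ← f.map_prob, div_self h]⟩

theorem posterior_mul_prob {a b : FinPS.{u}} (f : a ⟶ b) (x : a) (y : b) :
    posterior f y x * b.prob y = f.toFun x y * a.prob x := by
  unfold posterior
  split_ifs with h
  · rw [h, mul_zero]
    -- If `y` has measure zero, the non-negative terms summing to that measure all vanish.
    have h' := f.map_prob y
    rw [h, eq_comm, Finset.sum_eq_zero_iff_of_nonneg fun x _ =>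
      mul_nonneg (stdSimplex.zero_le _ _) (stdSimplex.zero_le _ _)] at h'
    exact (h' x (Finset.mem_univ x)).symm
  · exact div_mul_cancel₀ _ h

/-- A Bayesian inverse of `f`. -/
def bayesianInverse {a b : FinPS.{u}} (f : a ⟶ b) : b ⟶ a where
  toFun := posterior f
  map_prob x := by
    rw [Finset.sum_congr rfl fun y _ => posterior_mul_prob f x y, ← Finset.sum_mul,
      stdSimplex.sum_eq_one, one_mul]

theorem isBayesianInverse_bayesianInverse {a b : FinPS.{u}} (f : a ⟶ b) :
    IsBayesianInverse f (bayesianInverse f) :=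
  posterior_mul_prob f

/-- The joint distribution of a morphism, as a convex sum. -/
abbrev joint {a b : FinPS.{u}} (f : a ⟶ b) : FinPS.{u} :=
  a.convexSum fun x => ⟨b, f.toFun x⟩

/-- The exchange of the two components of a joint distribution. -/
def jointSwapEquiv {a b : FinPS.{u}} (f : a ⟶ b) (g : b ⟶ a) :
    (joint f).carrier ≃ (joint g).carrier where
  toFun z := ⟨z.2, z.1⟩
  invFun z := ⟨z.2, z.1⟩
  left_inv _ := rfl
  right_inv _ := rfl

theorem prob_jointSwapEquiv {a b : FinPS.{u}} {f : a ⟶ b} {g : b ⟶ a}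
    (h : IsBayesianInverse f g) (z : joint f) :
    (joint g).prob (jointSwapEquiv f g z) = (joint f).prob z := by
  change b.prob z.2 * g.toFun z.2 z.1 = a.prob z.1 * f.toFun z.1 z.2
  rw [mul_comm, h, mul_comm]

/-- The projection of a joint distribution to the target. -/
def jointSnd {a b : FinPS.{u}} (f : a ⟶ b) : joint f ⟶ b :=
  ofEquiv (jointSwapEquiv f (bayesianInverse f))
    (prob_jointSwapEquiv (isBayesianInverse_bayesianInverse f)) ≫ sumProj b _

-- `jointSnd` is routed through the joint distribution of a Bayesian inverse so that it is a
-- bijection followed by a `sumProj`, where `F` vanishes; the result does not depend on the inverse.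
open scoped Classical in
theorem jointSnd_apply {a b : FinPS.{u}} (f : a ⟶ b) (z : joint f) (y : b) :
    (jointSnd f).toFun z y = if y = z.2 then 1 else 0 := by
  rw [jointSnd, ofEquiv_comp_apply]
  rfl

/-- Only `(x, y)` contributes: the source fixes the first component and the target the second. This
yields both the factorisation of `f` and its mediator. -/
theorem sumBloom_jointSnd_apply {a b : FinPS.{u}} (f : a ⟶ b) (x : a) (y : b) :
    (sumBloom a (fun x => ⟨b, f.toFun x⟩) ≫ jointSnd f).toFun x y =
      (jointSnd f).toFun ⟨x, y⟩ y * (sumBloom a fun x => ⟨b, f.toFun x⟩).toFun x ⟨x, y⟩ := by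
  classical
  rw [comp_apply, Finset.sum_eq_single (⟨x, y⟩ : joint f)]
  · rintro ⟨x', y'⟩ _ hz
    by_cases hx : x' = x
    · subst hx
      rw [jointSnd_apply, if_neg, zero_mul]
      rintro rfl
      exact hz rfl
    · rw [sumBloom_of_ne a _ (show (⟨x', y'⟩ : joint f).1 ≠ x from hx), mul_zero]
  · simp

theorem sumBloom_comp_jointSnd {a b : FinPS.{u}} (f : a ⟶ b) :
    sumBloom a (fun x => ⟨b, f.toFun x⟩) ≫ jointSnd f = f := by
  refine hom_ext fun x y => ?_
  rw [sumBloom_jointSnd_apply, jointSnd_apply, sumBloom_same, if_pos rfl, one_mul]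

theorem aecoalescable_sumBloom_jointSnd {a b : FinPS.{u}} (f : a ⟶ b) :
    AECoalescable (sumBloom a fun x => ⟨b, f.toFun x⟩) (jointSnd f) :=
  ⟨fun yx => ⟨yx.2, yx.1⟩, fun y x _ => sumBloom_jointSnd_apply f x y⟩

end FinPS

end

/-! ### Reduction of `F` to its values on blooms. -/

namespace FinPS

/-- The axioms satisfied by a non-negative multiple of conditional entropy. -/
structure IsEntropic (F : MorphismFunction.{u}) : Prop where
  nonneg : ∀ ⦃a b : FinPS.{u}⦄ (f : a ⟶ b), 0 ≤ F f
  semiFunctorial : SemiFunctorial F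
  convexLinear : ConvexLinear F
  continuous : ContinuousFunction F
  bayes : EntropicBayesRule F

namespace IsEntropic

variable {F : MorphismFunction.{u}}

theorem map_id (hF : IsEntropic F) (a : FinPS.{u}) : F (𝟙 a) = 0 := by
  have h := hF.semiFunctorial (ofEquiv (a := a) (Equiv.refl _) fun _ => rfl)
    (ofEquiv (a := a) (Equiv.refl _) fun _ => rfl) (aecoalescable_ofEquiv_left _ _ _)
  have h1 : ofEquiv (a := a) (Equiv.refl _) (fun _ => rfl) = 𝟙 a := rfl
  rw [h1, Category.comp_id] at h
  linarith

/-- The values on a bijection and on its inverse are non-negative and add up to `F (𝟙 a) = 0`. -/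
theorem map_ofEquiv (hF : IsEntropic F) {a b : FinPS.{u}} (e : a.carrier ≃ b.carrier)
    (h : ∀ x : a, b.prob (e x) = a.prob x) : F (ofEquiv e h) = 0 := by
  have h' : ∀ y : b, a.prob (e.symm y) = b.prob y := fun y => by
    rw [← h, Equiv.apply_symm_apply]
  have key := hF.semiFunctorial (ofEquiv e h) (ofEquiv e.symm h') (aecoalescable_ofEquiv_left _ _ _)
  rw [ofEquiv_comp_symm, hF.map_id] at key
  linarith [hF.nonneg (ofEquiv e h), hF.nonneg (ofEquiv e.symm h')]

theorem map_bloom_congr (hF : IsEntropic F) {a b : FinPS.{u}} (e : a.carrier ≃ b.carrier)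
    (h : ∀ x : a, b.prob (e x) = a.prob x) : F (bloom a) = F (bloom b) := by
  have key := hF.semiFunctorial (bloom a) (ofEquiv e h) (aecoalescable_ofEquiv_right _ _ _)
  have hb : bloom a ≫ ofEquiv e h = bloom b := by
    classical
    refine hom_ext fun _ y => ?_
    exact ((ofEquiv e h).map_prob y).symm
  rw [hb, hF.map_ofEquiv] at key
  linarith

theorem map_sumBloom (hF : IsEntropic F) (a : FinPS.{u}) (Y : a → FinPS.{u}) :
    F (sumBloom a Y) = ∑ x : a, a.prob x * F (bloom (Y x)) := by
  rw [sumBloom, hF.semiFunctorial _ _ (aecoalescable_ofEquiv_left _ _ _), hF.map_ofEquiv,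
    hF.convexLinear, add_zero]

theorem map_bloom_convexSum (hF : IsEntropic F) (a : FinPS.{u}) (Y : a → FinPS.{u}) :
    F (bloom (a.convexSum Y)) = F (bloom a) + ∑ x : a, a.prob x * F (bloom (Y x)) := by
  rw [← bloom_comp_sumBloom, hF.semiFunctorial _ _ (aecoalescable_bloom_sumBloom a Y),
    hF.map_sumBloom, add_comm]

/-- In Bayes' rule for the projection and `sumBloom`, the chain rule cancels every other term. -/
theorem map_sumProj (hF : IsEntropic F) (a : FinPS.{u}) (Y : a → FinPS.{u}) :
    F (sumProj a Y) = 0 := by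
  have h := hF.bayes _ _ (isBayesianInverse_sumProj a Y)
  rw [hF.map_bloom_convexSum, hF.map_sumBloom] at h
  linarith

theorem map_eq_sum (hF : IsEntropic F) {a b : FinPS.{u}} (f : a ⟶ b) :
    F f = ∑ x : a, a.prob x * F (bloom ⟨b, f.toFun x⟩) := by
  have h := hF.semiFunctorial _ _ (aecoalescable_sumBloom_jointSnd f)
  rw [sumBloom_comp_jointSnd, hF.map_sumBloom, jointSnd,
    hF.semiFunctorial _ _ (aecoalescable_ofEquiv_left _ _ _), hF.map_ofEquiv, hF.map_sumProj,
    add_zero, zero_add] at h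
  exact h

theorem tendsto_map_bloom (hF : IsEntropic F) {X : Type u} [Fintype X] {p : ℕ → stdSimplex ℝ X}
    {p' : stdSimplex ℝ X} (h : Tendsto p atTop (𝓝 p')) :
    Tendsto (fun n => F (bloom ⟨X, p n⟩)) atTop (𝓝 (F (bloom ⟨X, p'⟩))) :=
  hF.continuous (fun n => Arrow.mk (bloom ⟨X, p n⟩)) (Arrow.mk (bloom ⟨X, p'⟩))
    ⟨0, fun _ => point.{u}.prob, p, fun n => bloom ⟨X, p n⟩, fun _ _ => rfl, tendsto_const_nhds,
      tendsto_pi_nhds.2 fun _ => h⟩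

/-- The bloom followed by the map to the point is the identity. With all mass at `x`, the constant
`x` is a mediator, so the two non-negative values add up to `0`. -/
theorem map_bloom_of_prob_eq_one (hF : IsEntropic F) {a : FinPS.{u}} {x : a}
    (hx : a.prob x = 1) : F (bloom a) = 0 := by
  have hc : AECoalescable (bloom a) (toPoint a) := by
    refine ⟨fun _ => x, fun z w _ => ?_⟩
    have h1 : (bloom a ≫ toPoint a).toFun w z = 1 := by
      change ∑ z : a, 1 * a.prob z = 1
      simp
    rw [h1]
    change 1 = 1 * a.prob x
    rw [hx, one_mul]
  have key := hF.semiFunctorial _ _ hc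
  rw [bloom_toPoint, hF.map_id] at key
  linarith [hF.nonneg (bloom a), hF.nonneg (toPoint a)]

end IsEntropic

/-! ### Uniform distributions and the logarithm. -/

/-- The uniform distribution on a nonempty finite type. -/
noncomputable abbrev uniform (X : Type u) [Fintype X] [Nonempty X] : FinPS.{u} where
  carrier := X
  prob := ⟨fun _ => (Fintype.card X : ℝ)⁻¹, fun _ => by positivity, by simp⟩

/-- The value of `F` on the uniform distribution with `n` elements, where `n` is positive. -/
noncomputable def uniformValue (F : MorphismFunction.{u}) (n : ℕ) : ℝ :=
  F (bloom (uniform (ULift.{u} (Fin (n - 1 + 1)))))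

namespace IsEntropic

variable {F : MorphismFunction.{u}}

theorem map_bloom_uniform (hF : IsEntropic F) (X : Type u) [Fintype X] [Nonempty X] :
    F (bloom (uniform X)) = uniformValue F (Fintype.card X) := by
  have hc : Fintype.card X = Fintype.card (ULift.{u} (Fin (Fintype.card X - 1 + 1))) := by
    have : 0 < Fintype.card X := Fintype.card_pos
    simp only [Fintype.card_ulift, Fintype.card_fin]
    omega
  refine hF.map_bloom_congr (Fintype.equivOfCardEq hc) fun x => ?_
  change (Fintype.card (ULift.{u} (Fin (Fintype.card X - 1 + 1))) : ℝ)⁻¹ = (Fintype.card X : ℝ)⁻¹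
  rw [← hc]

/-- This is the chain rule for a uniform set of `N = ∑ n x` elements cut into blocks of sizes `n x`:
the block `x` has weight `n x / N = p x`, and each block is uniform. -/
theorem uniformValue_sum (hF : IsEntropic F) {X : Type u} [Fintype X] (p : stdSimplex ℝ X)
    (n : X → ℕ) (hn : ∀ x, 0 < n x) (hp : ∀ x, p x * (∑ x, n x : ℕ) = n x) :
    uniformValue F (∑ x, n x) = F (bloom ⟨X, p⟩) + ∑ x, p x * uniformValue F (n x) := by
  have : ∀ x, Nonempty (ULift.{u} (Fin (n x))) := fun x => ⟨⟨⟨0, hn x⟩⟩⟩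
  have : Nonempty X := by
    by_contra h
    rw [not_nonempty_iff] at h
    simpa using stdSimplex.sum_eq_one p
  have : Nonempty (Σ x : X, ULift.{u} (Fin (n x))) := ⟨⟨Classical.arbitrary X, ⟨⟨0, hn _⟩⟩⟩⟩
  have h := hF.map_bloom_convexSum ⟨X, p⟩ fun x => uniform (ULift.{u} (Fin (n x)))
  have hcard : Fintype.card (Σ x : X, ULift.{u} (Fin (n x))) = ∑ x, n x := by simp
  have hN : ((∑ x, n x : ℕ) : ℝ) ≠ 0 := by
    have : 0 < Fintype.card (Σ x : X, ULift.{u} (Fin (n x))) := Fintype.card_pos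
    rw [hcard] at this
    positivity
  have hu := hF.map_bloom_uniform (Σ x : X, ULift.{u} (Fin (n x)))
  rw [hcard] at hu
  rw [← hu]
  simp_rw [hF.map_bloom_uniform, Fintype.card_ulift, Fintype.card_fin] at h
  rw [← h]
  refine hF.map_bloom_congr (Equiv.refl _) fun z => ?_
  change p z.1 * (Fintype.card (ULift.{u} (Fin (n z.1))) : ℝ)⁻¹ =
    (Fintype.card (Σ x : X, ULift.{u} (Fin (n x))) : ℝ)⁻¹
  have hz : (n z.1 : ℝ) ≠ 0 := by
    have := hn z.1
    positivity
  rw [hcard, Fintype.card_ulift, Fintype.card_fin, ← hp, mul_inv_rev,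
    mul_left_comm, mul_inv_cancel₀ (left_ne_zero_of_mul (hp z.1 ▸ hz)), mul_one]

theorem uniformValue_mul (hF : IsEntropic F) (m n : ℕ) (hm : 0 < m) (hn : 0 < n) :
    uniformValue F (m * n) = uniformValue F m + uniformValue F n := by
  have : Nonempty (ULift.{u} (Fin m)) := ⟨⟨⟨0, hm⟩⟩⟩
  have hm' : (m : ℝ) ≠ 0 := by positivity
  have hp : ∀ x, (uniform (ULift.{u} (Fin m))).prob x = (m : ℝ)⁻¹ := fun x => by
    change (Fintype.card (ULift.{u} (Fin m)) : ℝ)⁻¹ = _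
    simp
  have h := hF.uniformValue_sum (uniform (ULift.{u} (Fin m))).prob (fun _ => n) (fun _ => hn)
    fun x => by
      rw [hp]
      simp [hm']
  simp_rw [hp] at h
  have hu := hF.map_bloom_uniform (ULift.{u} (Fin m))
  simp only [Fintype.card_ulift, Fintype.card_fin] at hu
  simp only [Finset.sum_const, Finset.card_univ, Fintype.card_ulift, Fintype.card_fin, smul_eq_mul,
    nsmul_eq_mul] at h
  rw [mul_inv_cancel_left₀ hm'] at h
  rw [h, ← hu]

/-- The distribution on two points with weights `1 / (n + 1)` and `n / (n + 1)`. -/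
noncomputable def binary (n : ℕ) : stdSimplex ℝ (ULift.{u} (Fin 2)) :=
  ⟨fun i => ![1 / ((n : ℝ) + 1), n / (n + 1)] i.down,
    by
      rintro ⟨i⟩
      fin_cases i
      · simp; positivity
      · simp; positivity,
    by
      rw [← Equiv.ulift.symm.sum_comp]
      simp only [Equiv.ulift_symm_down, Fin.sum_univ_two, Matrix.cons_val_zero, Matrix.cons_val_one]
      field_simp
      ring⟩

/-- The distribution on two points concentrated at the second one. -/
noncomputable def binaryLimit : stdSimplex ℝ (ULift.{u} (Fin 2)) :=
  ⟨fun i => ![0, 1] i.down,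
    by
      rintro ⟨i⟩
      fin_cases i <;> simp,
    by
      rw [← Equiv.ulift.symm.sum_comp]
      simp⟩

theorem tendsto_binary : Tendsto binary.{u} atTop (𝓝 binaryLimit.{u}) := by
  rw [tendsto_subtype_rng, tendsto_pi_nhds]
  rintro ⟨i⟩
  fin_cases i
  · exact tendsto_one_div_add_atTop_nhds_zero_nat
  · exact tendsto_natCast_div_add_atTop 1

/-- Splitting `n + 1` elements into blocks of sizes `1` and `n` expresses the value of `F` on
`binary n` as a weighted difference of uniform values. It tends to `0` because `binary n` tends to a
point mass. -/
theorem tendsto_uniformValue_sub (hF : IsEntropic F) :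
    Tendsto (fun n => uniformValue F (n + 1) - uniformValue F n) atTop (𝓝 0) := by
  have h1 : uniformValue F 1 = 0 := by
    have := hF.uniformValue_mul 1 1 one_pos one_pos
    rw [mul_one] at this
    linarith
  refine tendsto_sub_of_weighted_recursion (fun n => hF.nonneg _) ?_
  have h0 : F (bloom ⟨ULift.{u} (Fin 2), binaryLimit⟩) = 0 :=
    hF.map_bloom_of_prob_eq_one (x := ULift.up 1) rfl
  have hl := hF.tendsto_map_bloom tendsto_binary
  rw [h0] at hl
  refine hl.congr' ?_
  filter_upwards [eventually_gt_atTop 0] with n hn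
  have hs : ∑ i : ULift.{u} (Fin 2), ![1, n] i.down = n + 1 := by
    rw [← Equiv.ulift.symm.sum_comp]
    simp [add_comm]
  have h := hF.uniformValue_sum (binary n) (fun i => ![1, n] i.down)
    (by
      rintro ⟨i⟩
      fin_cases i
      · exact one_pos
      · exact hn)
    (by
      rw [hs]
      push_cast
      rintro ⟨i⟩
      fin_cases i
      · change 1 / ((n : ℝ) + 1) * (n + 1) = ((1 : ℕ) : ℝ)
        rw [div_mul_cancel₀ _ (by positivity), Nat.cast_one]
      · change (n : ℝ) / (n + 1) * (n + 1) = n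
        rw [div_mul_cancel₀ _ (by positivity)])
  have hs' : ∑ i : ULift.{u} (Fin 2), binary n i * uniformValue F (![1, n] i.down) =
      n / (n + 1) * uniformValue F n := by
    rw [← Equiv.ulift.symm.sum_comp, Fin.sum_univ_two]
    change _ * uniformValue F 1 + (n : ℝ) / (n + 1) * uniformValue F n = _
    rw [h1, mul_zero, zero_add]
  rw [hs, hs'] at h
  rw [h, add_sub_cancel_right]

theorem uniformValue_eq (hF : IsEntropic F) {n : ℕ} (hn : 0 < n) :
    uniformValue F n = uniformValue F 2 / Real.log 2 * Real.log n :=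
  eq_mul_log_of_additive hF.uniformValue_mul hF.tendsto_uniformValue_sub n hn

/-- With `N = ∑ n x` and `n x = p x * N`, the block formula gives a multiple of `log N - ∑ p x * log
(p x * N)`, in which `log N` cancels. -/
theorem map_bloom_of_rational (hF : IsEntropic F) {X : Type u} [Fintype X] (p : stdSimplex ℝ X)
    (n : X → ℕ) (hn : ∀ x, 0 < n x) (hp : ∀ x, p x * (∑ x, n x : ℕ) = n x) :
    F (bloom ⟨X, p⟩) = uniformValue F 2 / Real.log 2 * shannonEntropy p := by
  have h := hF.uniformValue_sum p n hn hp
  have hpos : ∀ x, 0 < p x ∧ 0 < ((∑ x, n x : ℕ) : ℝ) := by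
    intro x
    have h1 : (0 : ℝ) < p x * (∑ x, n x : ℕ) := by
      rw [hp]
      exact_mod_cast hn x
    exact (pos_and_pos_or_neg_and_neg_of_mul_pos h1).resolve_right fun h2 =>
      absurd h2.1 (stdSimplex.zero_le p x).not_gt
  have hN : 0 < ∑ x, n x := by
    rw [Finset.sum_pos_iff]
    by_contra! h0
    have : IsEmpty X := ⟨fun x => absurd (h0 x (Finset.mem_univ x)) (hn x).not_ge⟩
    simpa using stdSimplex.sum_eq_one p
  rw [hF.uniformValue_eq hN] at h
  have hterm : ∀ x, p x * uniformValue F (n x) = uniformValue F 2 / Real.log 2 *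
      (p x * Real.log (p x) + p x * Real.log (∑ x, n x : ℕ)) := by
    intro x
    rw [hF.uniformValue_eq (hn x), ← hp x, Real.log_mul (hpos x).1.ne' (hpos x).2.ne']
    ring
  simp_rw [hterm] at h
  rw [← Finset.mul_sum, Finset.sum_add_distrib, ← Finset.sum_mul, stdSimplex.sum_eq_one,
    one_mul] at h
  rw [shannonEntropy]
  linarith

end IsEntropic

/-! ### Density of rational measures and the general formula. -/

/-- The rational approximation of `p` with weights proportional to `⌊k p_x⌋ + 1`. -/
noncomputable def rationalApprox {X : Type u} [Fintype X] (p : stdSimplex ℝ X) (k : ℕ) :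
    stdSimplex ℝ X :=
  ⟨fun x => ((⌊p x * k⌋₊ + 1 : ℕ) : ℝ) / (∑ x, (⌊p x * k⌋₊ + 1) : ℕ), fun x => by positivity, by
    rw [← Finset.sum_div, ← Nat.cast_sum, div_self]
    rw [Nat.cast_ne_zero]
    intro h
    rw [Finset.sum_eq_zero_iff] at h
    have : IsEmpty X := ⟨fun x => absurd (h x (Finset.mem_univ x)) (Nat.succ_ne_zero _)⟩
    simpa using stdSimplex.sum_eq_one p⟩

/-- After division by `k`, the numerators tend to `p x` and their total to `1`. The added `1`
disappears in the limit, but keeps every block nonempty even where `p x = 0`. -/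
theorem tendsto_rationalApprox {X : Type u} [Fintype X] (p : stdSimplex ℝ X) :
    Tendsto (rationalApprox p) atTop (𝓝 p) := by
  rw [tendsto_subtype_rng, tendsto_pi_nhds]
  intro x
  have h1 : ∀ x, Tendsto (fun k : ℕ => ((⌊p x * k⌋₊ + 1 : ℕ) : ℝ) / k) atTop (𝓝 (p x)) := by
    intro x
    have h2 := ((tendsto_nat_floor_mul_div_atTop (stdSimplex.zero_le p x)).comp
      (tendsto_natCast_atTop_atTop (R := ℝ))).add (tendsto_one_div_atTop_nhds_zero_nat (𝕜 := ℝ))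
    rw [add_zero] at h2
    refine h2.congr fun k => ?_
    simp [add_div]
  have h3 : Tendsto (fun k : ℕ => ((∑ x, (⌊p x * k⌋₊ + 1) : ℕ) : ℝ) / k) atTop (𝓝 1) := by
    have h4 := tendsto_finsetSum Finset.univ fun x _ => h1 x
    rw [stdSimplex.sum_eq_one] at h4
    refine h4.congr fun k => ?_
    rw [← Finset.sum_div, Nat.cast_sum]
  have h5 := (h1 x).div h3 one_ne_zero
  rw [div_one] at h5
  refine h5.congr' ?_
  filter_upwards [eventually_gt_atTop 0] with k hk
  exact div_div_div_cancel_right₀ (by positivity) _ _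

theorem IsEntropic.map_bloom_eq {F : MorphismFunction.{u}} (hF : IsEntropic F) {X : Type u}
    [Fintype X] (p : stdSimplex ℝ X) :
    F (bloom ⟨X, p⟩) = uniformValue F 2 / Real.log 2 * shannonEntropy p := by
  refine tendsto_nhds_unique (hF.tendsto_map_bloom (tendsto_rationalApprox p)) ?_
  have h := ((continuous_shannonEntropy.tendsto p).comp (tendsto_rationalApprox p)).const_mul
    (uniformValue F 2 / Real.log 2)
  refine h.congr fun k => (hF.map_bloom_of_rational _ (fun x => ⌊p x * k⌋₊ + 1)
    (fun x => Nat.succ_pos _) fun x => ?_).symm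
  refine div_mul_cancel₀ _ ?_
  rw [Nat.cast_ne_zero]
  exact (lt_of_lt_of_le (Nat.succ_pos _) (Finset.single_le_sum
    (f := fun x => ⌊p x * k⌋₊ + 1) (fun _ _ => Nat.zero_le _) (Finset.mem_univ x))).ne'

theorem IsEntropic.eq_mul_condEntropy {F : MorphismFunction.{u}} (hF : IsEntropic F)
    {a b : FinPS.{u}} (f : a ⟶ b) :
    F f = uniformValue F 2 / Real.log 2 * condEntropy f := by
  rw [hF.map_eq_sum, condEntropy, Finset.mul_sum]
  refine Finset.sum_congr rfl fun x _ => ?_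
  rw [hF.map_bloom_eq]
  ring

end FinPS

theorem theorem8p1 :
    (∀ F : FinPS.MorphismFunction.{u},
      (∀ ⦃a b : FinPS.{u}⦄ (f : a ⟶ b), 0 ≤ F f) →
      FinPS.SemiFunctorial F →
      FinPS.ConvexLinear F →
      FinPS.ContinuousFunction F →
      FinPS.EntropicBayesRule F →
      ∃ c : ℝ, 0 ≤ c ∧ ∀ ⦃a b : FinPS.{u}⦄ (f : a ⟶ b), F f = c * FinPS.condEntropy f) ∧
    ((∀ ⦃a b : FinPS.{u}⦄ (f : a ⟶ b), 0 ≤ FinPS.condEntropy f) ∧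
      FinPS.SemiFunctorial FinPS.condEntropy.{u} ∧
      FinPS.ConvexLinear FinPS.condEntropy.{u} ∧
      FinPS.ContinuousFunction FinPS.condEntropy.{u} ∧
      FinPS.EntropicBayesRule FinPS.condEntropy.{u}) := by
  refine ⟨fun F h0 h1 h2 h3 h4 => ?_, fun _ _ f => FinPS.condEntropy_nonneg f,
    FinPS.condEntropy_semiFunctorial, FinPS.condEntropy_convexLinear,
    FinPS.condEntropy_continuousFunction, FinPS.condEntropy_entropicBayesRule⟩
  have hF : FinPS.IsEntropic F := ⟨h0, h1, h2, h3, h4⟩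
  -- The constant is the value of `F` on a fair coin divided by the coin's entropy.
  exact ⟨FinPS.uniformValue F 2 / Real.log 2,
    div_nonneg (h0 _) (Real.log_pos one_lt_two).le, fun _ _ f => hF.eq_mul_condEntropy f⟩
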